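/- Let $E$ and $F$ be Archimedean Riesz spaces (real vector lattices). Let $F^\delta$ be an order completion of $F$, i.e. a Riesz space in which every nonempty subset bounded above has a supremum, together with a linear map $i:F\to F^\delta$ that is bipositive ($i(y)\ge 0\iff y\ge 0$) and such that $i(F)$ is majorizing and pervasive in $F^\delta$. Here a subspace $Y$ of a partially ordered vector space $X$ is majorizing if every $x\in X$ satisfies $x\le y$ for some $y\in Y$, and pervasive if for every $x>0$ in $X$ there is $y\in Y$ with $0<y\le x$. For a Riesz space $E$ and a partially ordered vector space $G$, let $\mathcal L^r(E,G)$ be the space of regular operators (differences of two positive linear operators $E\to G$) with the order $S\le T\iff S(x)\le T(x)$ for all $x\ge 0$. Regard $\mathcal L^r(E,i(F))$ as a subspace of $\mathcal L^r(E,F^\delta)$. Let $\mathcal L^{oc}(E,F)$ be the space of order continuous operators, i.e. linear $T:E\to F$ such that $x_\alpha\xrightarrow{o}0$ implies $T(x_\alpha)\xrightarrow{o}0$ for all nets in $E$; here $x_\alpha\xrightarrow{o}x$ means that there is a net $(b_\gamma)$, possibly over another index set, with $b_\gamma\downarrow 0$ such that for every $\gamma$ there is $\alpha_0$ with $|x_\alpha-x|\le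 b_\gamma$ for all $\alpha\ge\alpha_0$. Suppose that $\mathcal L^r(E,i(F))$ is pervasive in $\mathcal L^r(E,F^\delta)$. Then: 1. $\mathcal L^r(E,F^\delta)$ is a Riesz space. Let $\mathcal S$ be its Riesz subspace generated by $\mathcal L^r(E,i(F))$, i.e. the smallest linear subspace that contains $\mathcal L^r(E,i(F))$ and is closed under binary suprema. Then $\mathcal S$, with the embedding $j:T\mapsto i\circ T$, is a Riesz completion of $\mathcal L^r(E,F)$: $\mathcal S$ is a Riesz space, $j:\mathcal L^r(E,F)\to\mathcal S$ is linear and bipositive, its image is order dense in $\mathcal S$ (every $s\in\mathcal S$ is both the supremum of the elements of the image below $s$ and the infimum of the elements of the image above $s$), and its image generates $\mathcal S$ as a Riesz space. 2. $\mathcal L^r(E,F)$ has the Riesz–Kantorovich property: for each $T\in\mathcal L^r(E,F)$ such that $T^+=\sup\{T,0\}$ exists in $\mathcal L^r(E,F)$, one has $T^+(x)=\sup\{T(y)\mid 0\le y\le x\}$ for every $x\in E$ with $x\ge 0$. 3. $\mathcal B=\mathcal L^{oc}(E,F)\cap\mathcal L^r(E,F)$ is a band of $X=\mathcal L^r(E,F)$: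 it is a linear subspace with $\mathcal B^{dd}=\mathcal B$. Here $x,y\in X$ are disjoint if $\{x+y,-x-y\}$ and $\{x-y,-x+y\}$ have the same upper bounds in $X$, and $Y^d$ is the set of all $x\in X$ that are disjoint from every $y\in Y$. -/

import Mathlib

universe u v w

/-! ### Partially ordered vector spaces -/

namespace PreRiesz

section POVS

variable {X : Type u} [AddCommGroup X] [PartialOrder X] [Module ℝ X]

/-- A subspace of a partially ordered vector space is ordered by restriction; this order is
compatible with addition. -/
instance submodule_isOrderedAddMonoid [IsOrderedAddMonoid X] (S : Submodule ℝ X) :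
    IsOrderedAddMonoid S where
  add_le_add_left a b h c := by
    change (a : X) + c ≤ (b : X) + c
    exact add_le_add_left (show (a : X) ≤ b from h) (c : X)

/-- The order of a subspace is compatible with scalar multiplication. -/
instance submodule_isOrderedModule [IsOrderedModule ℝ X] (S : Submodule ℝ X) :
    IsOrderedModule ℝ S where
  smul_le_smul_of_nonneg_left c hc a b h := by
    change c • (a : X) ≤ c • (b : X)
    exact smul_le_smul_of_nonneg_left (show (a : X) ≤ b from h) hc
  smul_le_smul_of_nonneg_right a ha c d h := by
    change c • (a : X) ≤ d • (a : X)
    exact smul_le_smul_of_nonneg_right h (show (0 : X) ≤ a from ha)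

/-- `X` is Archimedean: `n x ≤ y` for all `n ∈ ℕ` implies `x ≤ 0`.  (Mathlib's class `Archimedean`
is a different, much stronger notion for spaces that are not totally ordered.) -/
def IsArchimedean (X : Type u) [AddCommGroup X] [PartialOrder X] : Prop :=
  ∀ x y : X, (∀ n : ℕ, n • x ≤ y) → x ≤ 0

/-- A partially ordered vector space is a Riesz space if every pair of elements has a supremum and
an infimum. -/
def IsRieszSpace (X : Type u) [AddCommGroup X] [PartialOrder X] [IsOrderedAddMonoid X]
    [Module ℝ X] [IsOrderedModule ℝ X] : Prop :=
  ∀ x y : X, (∃ s, IsLUB {x, y} s) ∧ (∃ t, IsGLB {x, y} t)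

/-- `Y` is pervasive in `X`. -/
def IsPervasive (Y : Set X) : Prop :=
  ∀ x : X, 0 < x → ∃ y ∈ Y, 0 < y ∧ y ≤ x

/-- `Y` is majorizing in `X`. -/
def IsMajorizing (Y : Set X) : Prop :=
  ∀ x : X, ∃ y ∈ Y, x ≤ y

/-- `Y` is order dense in `X`: `x = sup {y ∈ Y | y ≤ x} = inf {y ∈ Y | x ≤ y}` for all `x`. -/
def IsOrderDense (Y : Set X) : Prop :=
  ∀ x : X, IsLUB {y | y ∈ Y ∧ y ≤ x} x ∧ IsGLB {y | y ∈ Y ∧ x ≤ y} x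

/-- A Riesz subspace of a Riesz space `X`: a linear subspace that contains the supremum in `X` of
any two of its elements. -/
def IsRieszSubspace (S : Submodule ℝ X) : Prop :=
  ∀ x ∈ S, ∀ y ∈ S, ∀ z : X, IsLUB {x, y} z → z ∈ S

/-- The Riesz subspace of a Riesz space `X` generated by `Y`: the smallest Riesz subspace that
contains `Y`. -/
def rieszSubspaceGenerated (Y : Set X) : Submodule ℝ X :=
  sInf {S | IsRieszSubspace S ∧ Y ⊆ (S : Set X)}

/-- Disjointness in a partially ordered vector space: `{x + y, -x - y}` and `{x - y, -x + y}` have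
the same upper bounds. -/
def IsDisjoint (x y : X) : Prop :=
  upperBounds {x + y, -x - y} = upperBounds {x - y, -x + y}

/-- The disjoint complement of `Y` in `X`. -/
def disjointComplement (Y : Set X) : Set X :=
  {x | ∀ y ∈ Y, IsDisjoint x y}

/-- A band of `X`: a linear subspace that equals its double disjoint complement. -/
def IsBand (Y : Set X) : Prop :=
  (∃ S : Submodule ℝ X, (S : Set X) = Y) ∧ disjointComplement (disjointComplement Y) = Y

end POVS

/-- A linear map is bipositive if `0 ≤ x ↔ 0 ≤ i x`. -/
def IsBipositive {X : Type u} {Y : Type v} [AddCommGroup X] [PartialOrder X] [Module ℝ X]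
    [AddCommGroup Y] [PartialOrder Y] [Module ℝ Y] (i : X →ₗ[ℝ] Y) : Prop :=
  ∀ x : X, 0 ≤ i x ↔ 0 ≤ x

/-- `R`, together with the linear map `j : X → R`, is a Riesz completion of `X`: `R` is a Riesz
space, `j` is bipositive, `j(X)` is order dense in `R`, and `j(X)` generates `R` as a Riesz
space. -/
structure IsRieszCompletion {X : Type u} {R : Type v}
    [AddCommGroup X] [PartialOrder X] [IsOrderedAddMonoid X] [Module ℝ X] [IsOrderedModule ℝ X]
    [AddCommGroup R] [PartialOrder R] [IsOrderedAddMonoid R] [Module ℝ R] [IsOrderedModule ℝ R]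
    (j : X →ₗ[ℝ] R) : Prop where
  isRieszSpace : IsRieszSpace R
  bipositive : IsBipositive j
  orderDense : IsOrderDense (Set.range j)
  generates : rieszSubspaceGenerated (Set.range j) = ⊤

/-! ### Order completions and order convergence in Riesz spaces -/

/-- Order completeness: every nonempty subset that is bounded above has a supremum. -/
def IsOrderComplete (X : Type u) [PartialOrder X] : Prop :=
  ∀ s : Set X, s.Nonempty → BddAbove s → ∃ x, IsLUB s x

/-- The Riesz space `D`, together with the linear map `i : X → D`, is an order completion of `X`. -/
structure IsOrderCompletion {X : Type u} {D : Type v}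
    [AddCommGroup X] [Lattice X] [IsOrderedAddMonoid X] [Module ℝ X] [IsOrderedModule ℝ X]
    [AddCommGroup D] [Lattice D] [IsOrderedAddMonoid D] [Module ℝ D] [IsOrderedModule ℝ D]
    (i : X →ₗ[ℝ] D) : Prop where
  orderComplete : IsOrderComplete D
  bipositive : IsBipositive i
  majorizing : IsMajorizing (Set.range i)
  pervasive : IsPervasive (Set.range i)

/-- Order convergence `x_α →ᵒ l` of a net: there is a net `(b_γ)`, possibly over another index
set, such that `b_γ ↓ 0` and for every `γ`, eventually `|x_α - l| ≤ b_γ`.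
(Only the set of values of `(b_γ)` matters, so index sets in the universe of `X` are enough.) -/
def OrderConverges {X : Type u} [AddCommGroup X] [Lattice X]
    {A : Type v} [Preorder A] (x : A → X) (l : X) : Prop :=
  ∃ (Γ : Type u) (_ : Preorder Γ) (_ : Nonempty Γ) (_ : IsDirected Γ (· ≤ ·)) (b : Γ → X),
    Antitone b ∧ IsGLB (Set.range b) 0 ∧ ∀ γ, ∃ α₀, ∀ α, α₀ ≤ α → |x α - l| ≤ b γ

/-- A linear operator is order continuous if it maps nets that converge in order to `0` to nets
that converge in order to `0`.  (Order convergence depends only on the filter of tails of the net,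
and each filter on `E` is the filter of tails of a net indexed in the universe of `E`, so such index
sets are enough.) -/
def IsOrderContinuous {E : Type u} {F : Type v} [AddCommGroup E] [Lattice E] [Module ℝ E]
    [AddCommGroup F] [Lattice F] [Module ℝ F] (T : E →ₗ[ℝ] F) : Prop :=
  ∀ (A : Type u) [Preorder A] [Nonempty A] [IsDirected A (· ≤ ·)] (x : A → E),
    OrderConverges x 0 → OrderConverges (fun α => T (x α)) 0

/-! ### Regular operators -/

section Regular

/-- Positive operators map positive elements to positive elements. -/
def IsPositiveOp {E : Type u} {F : Type v} [AddCommGroup E] [PartialOrder E] [Module ℝ E]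
    [AddCommGroup F] [PartialOrder F] [Module ℝ F] (T : E →ₗ[ℝ] F) : Prop :=
  ∀ x : E, 0 ≤ x → 0 ≤ T x

/-- The space `𝓛ʳ(E, F)` of regular operators: differences of two positive operators. -/
def Lr (E : Type u) (F : Type v) [AddCommGroup E] [PartialOrder E] [Module ℝ E]
    [AddCommGroup F] [PartialOrder F] [IsOrderedAddMonoid F] [Module ℝ F] [IsOrderedModule ℝ F] :
    Submodule ℝ (E →ₗ[ℝ] F) where
  carrier := {T | ∃ A B : E →ₗ[ℝ] F, IsPositiveOp A ∧ IsPositiveOp B ∧ T = A - B}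
  zero_mem' := ⟨0, 0, fun _ _ => le_rfl, fun _ _ => le_rfl, by simp⟩
  add_mem' := by
    rintro _ _ ⟨A, B, hA, hB, rfl⟩ ⟨A', B', hA', hB', rfl⟩
    exact ⟨A + A', B + B', fun x hx => add_nonneg (hA x hx) (hA' x hx),
      fun x hx => add_nonneg (hB x hx) (hB' x hx), by abel⟩
  smul_mem' := by
    rintro c _ ⟨A, B, hA, hB, rfl⟩
    rcases le_total 0 c with hc | hc
    · exact ⟨c • A, c • B, fun x hx => smul_nonneg hc (hA x hx),
        fun x hx => smul_nonneg hc (hB x hx), smul_sub c A B⟩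
    · exact ⟨(-c) • B, (-c) • A, fun x hx => smul_nonneg (neg_nonneg.2 hc) (hB x hx),
        fun x hx => smul_nonneg (neg_nonneg.2 hc) (hA x hx), by module⟩

variable {E : Type u} {F : Type v}
  [AddCommGroup E] [Lattice E] [IsOrderedAddMonoid E] [Module ℝ E]
  [AddCommGroup F] [PartialOrder F] [IsOrderedAddMonoid F] [Module ℝ F] [IsOrderedModule ℝ F]

/-- The pointwise order on `𝓛ʳ(E, F)`: `S ≤ T` if `S x ≤ T x` for all `x ≥ 0`. -/
instance instPartialOrderLr : PartialOrder (Lr E F) where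
  le S T := ∀ x : E, 0 ≤ x → S.1 x ≤ T.1 x
  le_refl _ _ _ := le_rfl
  le_trans _ _ _ h h' x hx := (h x hx).trans (h' x hx)
  le_antisymm S T h h' := by
    have key : ∀ x : E, 0 ≤ x → S.1 x = T.1 x := fun x hx => le_antisymm (h x hx) (h' x hx)
    refine Subtype.ext (LinearMap.ext fun x => ?_)
    rw [← posPart_sub_negPart x, map_sub, map_sub, key _ (posPart_nonneg x),
      key _ (negPart_nonneg x)]

instance instIsOrderedAddMonoidLr : IsOrderedAddMonoid (Lr E F) where
  add_le_add_left S T h R x hx := by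
    change S.1 x + R.1 x ≤ T.1 x + R.1 x
    exact add_le_add_left (h x hx) (R.1 x)

instance instIsOrderedModuleLr : IsOrderedModule ℝ (Lr E F) where
  smul_le_smul_of_nonneg_left c hc S T h x hx := by
    change c • S.1 x ≤ c • T.1 x
    exact smul_le_smul_of_nonneg_left (h x hx) hc
  smul_le_smul_of_nonneg_right S hS c d h x hx := by
    change c • S.1 x ≤ d • S.1 x
    exact smul_le_smul_of_nonneg_right h (hS x hx)

/-- For a subspace `G` of `F`, the space `𝓛ʳ(E, G)` regarded as a subset of `𝓛ʳ(E, F)`: the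
operators `T` that are regular as operators from `E` to the partially ordered vector space `G`. -/
def LrInto (E : Type u) {F : Type v}
    [AddCommGroup E] [Lattice E] [IsOrderedAddMonoid E] [Module ℝ E]
    [AddCommGroup F] [PartialOrder F] [IsOrderedAddMonoid F] [Module ℝ F] [IsOrderedModule ℝ F]
    (G : Submodule ℝ F) : Set (Lr E F) :=
  {T | ∃ R : Lr E G, ∀ x : E, T.1 x = (R.1 x : F)}

/-- The Riesz–Kantorovich property of `𝓛ʳ(E, F)`: whenever `T⁺ = T ∨ 0` exists in `𝓛ʳ(E, F)`, it
satisfies `T⁺ x = sup {T y | 0 ≤ y ≤ x}` for all `x ≥ 0`. -/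
def HasRieszKantorovichProperty (E : Type u) (F : Type v)
    [AddCommGroup E] [Lattice E] [IsOrderedAddMonoid E] [Module ℝ E]
    [AddCommGroup F] [PartialOrder F] [IsOrderedAddMonoid F] [Module ℝ F] [IsOrderedModule ℝ F] :
    Prop :=
  ∀ T P : Lr E F, IsLUB {T, 0} P → ∀ x : E, 0 ≤ x → IsLUB (T.1 '' Set.Icc 0 x) (P.1 x)

end Regular

end PreRiesz

set_option linter.unusedSectionVars false

/-! Since `Fδ` is order complete, the Riesz–Kantorovich formula makes `Lr E Fδ` an Archimedean Riesz
space. Composition with `i` is a bipositive map `j` from `Lr E F` onto `LrInto E (LinearMap.range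
i)`, so the hypothesis says that `j` has pervasive range. Everything else is drawn from this.

Completion: in an Archimedean Riesz space, an element lying between two members of a pervasive
subspace is the supremum and the infimum of the members below and above it (`IsPervasive.isLUB`,
`IsPervasive.isGLB`). Every operator in the generated Riesz subspace has its modulus below some `j
S`, so it lies between two such members.

Riesz–Kantorovich: a bipositive map with pervasive range preserves existing suprema of pairs. Hence
`j P` is the positive part of `j T`, which obeys the formula in `Fδ`, and `i` reflects the supremum.

Band: `T` is order continuous iff `|j T|` sends downward directed sets with infimum `0` to sets with
infimum `0` (`isOrderContinuous_iff`). Positive operators with this property form a solid cone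
closed under pointwise directed suprema, so below each positive operator there is a largest one. The
gap between `|j T|` and that largest part, if nonzero, dominates some `j z > 0` with `z` disjoint
from every order continuous operator; `isBand_setOf_abs_mem` turns this into `𝓑ᵈᵈ = 𝓑`. -/

namespace PreRiesz

/-! ### Suprema of sums and of scalar multiples -/

section Bounds

variable {D : Type v} [AddCommGroup D] [PartialOrder D] [IsOrderedAddMonoid D]

/-- The set `r` need not be `s + t`: it is enough that it dominates `s + t` and stays below `a + b`.
This slack is what directed families of operators require. -/
theorem isLUB_of_add {s t r : Set D} {a b : D} (ha : IsLUB s a) (hb : IsLUB t b)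
    (hle : ∀ z ∈ r, z ≤ a + b) (hmem : ∀ x ∈ s, ∀ y ∈ t, ∃ z ∈ r, x + y ≤ z) :
    IsLUB r (a + b) := by
  refine ⟨hle, fun u hu => ?_⟩
  have h1 : ∀ x ∈ s, b ≤ u - x := fun x hx => hb.2 fun y hy => by
    obtain ⟨z, hz, hxy⟩ := hmem x hx y hy
    exact le_sub_iff_add_le'.2 (hxy.trans (hu hz))
  have h2 : a ≤ u - b := ha.2 fun x hx => by
    have := h1 x hx
    rwa [le_sub_comm]
  exact le_sub_iff_add_le.1 h2

theorem isLUB_smul_of_pos [Module ℝ D] [IsOrderedModule ℝ D] {s t : Set D} {a : D} {c : ℝ}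
    (hc : 0 < c) (h : IsLUB s a) (hst : t = (fun y => c • y) '' s) : IsLUB t (c • a) := by
  rw [hst]
  exact (OrderIso.isLUB_image' (OrderIso.smulRight (β := D) hc)).2 h

end Bounds

/-! ### Extending additive maps from the positive cone -/

section ConeExtension

variable {E : Type u} {D : Type v} [AddCommGroup E] [Lattice E] [IsOrderedAddMonoid E]
  [Module ℝ E] [IsOrderedModule ℝ E] [AddCommGroup D] [Module ℝ D]

/-- A map that is additive and positively homogeneous on the positive cone of a Riesz space
agrees on the cone with a linear map. -/
theorem exists_linearMap_eq_on_nonneg (p : E → D)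
    (hadd : ∀ x y, 0 ≤ x → 0 ≤ y → p (x + y) = p x + p y)
    (hsmul : ∀ c : ℝ, 0 < c → ∀ x, 0 ≤ x → p (c • x) = c • p x) :
    ∃ L : E →ₗ[ℝ] D, ∀ x, 0 ≤ x → L x = p x := by
  -- The difference `p a - p b` depends only on `a - b`, so any positive decomposition may replace
  -- the canonical one.
  have key : ∀ a b : E, 0 ≤ a → 0 ≤ b → p (a - b)⁺ - p (a - b)⁻ = p a - p b := by
    intro a b ha hb
    have h : (a - b)⁺ + b = a + (a - b)⁻ := by
      have := posPart_sub_negPart (a - b)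
      rw [sub_eq_sub_iff_add_eq_add] at this
      exact this
    have h' := congrArg p h
    rw [hadd _ _ (posPart_nonneg _) hb, hadd _ _ ha (negPart_nonneg _)] at h'
    rwa [sub_eq_sub_iff_add_eq_add]
  have hp0 : p 0 = 0 := by simpa using hadd 0 0 le_rfl le_rfl
  refine ⟨⟨⟨fun x => p x⁺ - p x⁻, fun x y => ?_⟩, fun c x => ?_⟩, fun x hx => ?_⟩
  · have h : x + y = (x⁺ + y⁺) - (x⁻ + y⁻) := by
      conv_lhs => rw [← posPart_sub_negPart x, ← posPart_sub_negPart y]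
      abel
    rw [h, key _ _ (add_nonneg (posPart_nonneg _) (posPart_nonneg _))
      (add_nonneg (negPart_nonneg _) (negPart_nonneg _)),
      hadd _ _ (posPart_nonneg _) (posPart_nonneg _),
      hadd _ _ (negPart_nonneg _) (negPart_nonneg _)]
    abel
  · simp only [RingHom.id_apply]
    rcases lt_trichotomy c 0 with hc | rfl | hc
    · have hc' : 0 < -c := neg_pos.2 hc
      have h : c • x = (-c) • x⁻ - (-c) • x⁺ := by
        conv_lhs => rw [← posPart_sub_negPart x]
        module
      rw [h, key _ _ (smul_nonneg hc'.le (negPart_nonneg _))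
        (smul_nonneg hc'.le (posPart_nonneg _)), hsmul _ hc' _ (negPart_nonneg _),
        hsmul _ hc' _ (posPart_nonneg _)]
      module
    · simp
    · have h : c • x = c • x⁺ - c • x⁻ := by
        conv_lhs => rw [← posPart_sub_negPart x]
        module
      rw [h, key _ _ (smul_nonneg hc.le (posPart_nonneg _))
        (smul_nonneg hc.le (negPart_nonneg _)), hsmul _ hc _ (posPart_nonneg _),
        hsmul _ hc _ (negPart_nonneg _)]
      module
  · change p x⁺ - p x⁻ = p x
    simp [posPart_of_nonneg hx, negPart_eq_zero.2 hx, hp0]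

end ConeExtension

/-! ### The Riesz space of regular operators into an order complete space -/

section OrderComplete

variable {E : Type u} {D : Type v} [AddCommGroup E] [Lattice E] [IsOrderedAddMonoid E]
  [Module ℝ E] [IsOrderedModule ℝ E] [AddCommGroup D] [PartialOrder D] [IsOrderedAddMonoid D]
  [Module ℝ D] [IsOrderedModule ℝ D]

theorem Lr.exists_pos_bound (T : Lr E D) : ∃ A : Lr E D, 0 ≤ A ∧ T ≤ A := by
  obtain ⟨T, A, B, hA, hB, rfl⟩ := T
  refine ⟨⟨A, A, 0, hA, fun _ _ => le_rfl, by simp⟩, hA, fun x hx => ?_⟩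
  exact sub_le_self _ (hB x hx)

theorem Lr.mono {T : Lr E D} (hT : 0 ≤ T) {x y : E} (h : x ≤ y) : T.1 x ≤ T.1 y := by
  have : 0 ≤ T.1 (y - x) := hT (y - x) (sub_nonneg.2 h)
  rwa [map_sub, sub_nonneg] at this

/-- The Riesz–Kantorovich formula: a regular operator into an order complete space has a positive
part. -/
theorem exists_isLUB_zero_of_isOrderComplete (hD : IsOrderComplete D) (T : Lr E D) :
    ∃ P : Lr E D, IsLUB {T, 0} P ∧ ∀ x : E, 0 ≤ x → IsLUB (T.1 '' Set.Icc 0 x) (P.1 x) := by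
  obtain ⟨A, hA, hTA⟩ := Lr.exists_pos_bound T
  have hex : ∀ x : E, ∃ s, 0 ≤ x → IsLUB (T.1 '' Set.Icc 0 x) s := by
    intro x
    by_cases hx : 0 ≤ x
    · obtain ⟨s, hs⟩ := hD (T.1 '' Set.Icc 0 x) ⟨_, 0, ⟨le_rfl, hx⟩, rfl⟩ ⟨A.1 x, by
        rintro _ ⟨y, hy, rfl⟩
        exact (hTA y hy.1).trans (Lr.mono hA hy.2)⟩
      exact ⟨s, fun _ => hs⟩
    · exact ⟨0, fun h => absurd h hx⟩
  choose p hp using hex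
  obtain ⟨L, hL⟩ := exists_linearMap_eq_on_nonneg p
    (by
      intro x y hx hy
      refine (hp _ (add_nonneg hx hy)).unique (isLUB_of_add (hp x hx) (hp y hy) ?_ ?_)
      · rintro _ ⟨z, hz, rfl⟩
        -- Riesz decomposition of `0 ≤ z ≤ x + y` into a part below `x` and a part below `y`.
        have h : T.1 z = T.1 (z ⊓ x) + T.1 (z - z ⊓ x) := by rw [← map_add]; congr 1; abel
        rw [h]
        refine add_le_add ((hp x hx).1 ⟨_, ⟨le_inf hz.1 hx, inf_le_right⟩, rfl⟩)
          ((hp y hy).1 ⟨_, ⟨sub_nonneg.2 inf_le_left, ?_⟩, rfl⟩)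
        rw [sub_le_comm]
        exact le_inf (sub_le_self _ hy) (sub_le_iff_le_add.2 hz.2)
      · rintro _ ⟨a, ha, rfl⟩ _ ⟨b, hb, rfl⟩
        exact ⟨_, ⟨a + b, ⟨add_nonneg ha.1 hb.1, add_le_add ha.2 hb.2⟩, rfl⟩, by simp⟩)
    (by
      intro c hc x hx
      refine (hp _ (smul_nonneg hc.le hx)).unique (isLUB_smul_of_pos hc (hp x hx) ?_)
      ext z
      constructor
      · rintro ⟨y, hy, rfl⟩
        refine ⟨_, ⟨c⁻¹ • y, ⟨smul_nonneg (inv_nonneg.2 hc.le) hy.1, ?_⟩, rfl⟩, ?_⟩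
        · exact (inv_smul_le_iff_of_pos hc).2 hy.2
        · simp [smul_smul, hc.ne']
      · rintro ⟨_, ⟨y, hy, rfl⟩, rfl⟩
        exact ⟨c • y, ⟨smul_nonneg hc.le hy.1, smul_le_smul_of_nonneg_left hy.2 hc.le⟩, by simp⟩)
  have hLUB : ∀ x : E, 0 ≤ x → IsLUB (T.1 '' Set.Icc 0 x) (L x) := fun x hx => by
    rw [hL x hx]
    exact hp x hx
  have hLpos : IsPositiveOp L := fun x hx => (hLUB x hx).1 ⟨0, ⟨le_rfl, hx⟩, by simp⟩
  refine ⟨⟨L, L, 0, hLpos, fun _ _ => le_rfl, by simp⟩, ⟨?_, ?_⟩, hLUB⟩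
  · rintro _ (rfl | rfl)
    · exact fun x hx => (hLUB x hx).1 ⟨x, ⟨hx, le_rfl⟩, rfl⟩
    · exact hLpos
  · intro Q hQ x hx
    refine (hLUB x hx).2 ?_
    rintro _ ⟨y, hy, rfl⟩
    exact (hQ (Set.mem_insert _ _) y hy.1).trans
      (Lr.mono (hQ (Set.mem_insert_of_mem _ rfl)) hy.2)

/-- Pointwise supremum of an upward directed set of positive operators. -/
theorem exists_isLUB_of_directedOn (hD : IsOrderComplete D) (s : Set (Lr E D)) (hs : s.Nonempty)
    (hdir : DirectedOn (· ≤ ·) s) (hpos : ∀ V ∈ s, 0 ≤ V) (hbdd : BddAbove s) :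
    ∃ U : Lr E D, IsLUB s U ∧ ∀ x : E, 0 ≤ x → IsLUB ((fun V : Lr E D => V.1 x) '' s) (U.1 x) := by
  obtain ⟨W, hW⟩ := hbdd
  have hex : ∀ x : E, ∃ a, 0 ≤ x → IsLUB ((fun V : Lr E D => V.1 x) '' s) a := by
    intro x
    by_cases hx : 0 ≤ x
    · obtain ⟨a, ha⟩ := hD ((fun V : Lr E D => V.1 x) '' s) (hs.image _) ⟨W.1 x, by
        rintro _ ⟨V, hV, rfl⟩
        exact hW hV x hx⟩
      exact ⟨a, fun _ => ha⟩
    · exact ⟨0, fun h => absurd h hx⟩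
  choose p hp using hex
  obtain ⟨L, hL⟩ := exists_linearMap_eq_on_nonneg p
    (by
      intro x y hx hy
      refine (hp _ (add_nonneg hx hy)).unique (isLUB_of_add (hp x hx) (hp y hy) ?_ ?_)
      · rintro _ ⟨V, hV, rfl⟩
        simp only [map_add]
        exact add_le_add ((hp x hx).1 ⟨V, hV, rfl⟩) ((hp y hy).1 ⟨V, hV, rfl⟩)
      · rintro _ ⟨V, hV, rfl⟩ _ ⟨V', hV', rfl⟩
        obtain ⟨Z, hZ, h, h'⟩ := hdir V hV V' hV'
        refine ⟨_, ⟨Z, hZ, rfl⟩, ?_⟩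
        simp only [map_add]
        exact add_le_add (h x hx) (h' y hy))
    (by
      intro c hc x hx
      refine (hp _ (smul_nonneg hc.le hx)).unique (isLUB_smul_of_pos hc (hp x hx) ?_)
      rw [Set.image_image]
      simp)
  have hLUB : ∀ x : E, 0 ≤ x → IsLUB ((fun V : Lr E D => V.1 x) '' s) (L x) := fun x hx => by
    rw [hL x hx]
    exact hp x hx
  have hLpos : IsPositiveOp L := fun x hx => by
    obtain ⟨V, hV⟩ := hs
    exact (hpos V hV x hx).trans ((hLUB x hx).1 ⟨V, hV, rfl⟩)
  refine ⟨⟨L, L, 0, hLpos, fun _ _ => le_rfl, by simp⟩, ⟨?_, ?_⟩, hLUB⟩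
  · exact fun V hV x hx => (hLUB x hx).1 ⟨V, hV, rfl⟩
  · intro Q hQ x hx
    refine (hLUB x hx).2 ?_
    rintro _ ⟨V, hV, rfl⟩
    exact hQ hV x hx

theorem IsOrderComplete.isArchimedean (hD : IsOrderComplete D) : IsArchimedean D := by
  intro x y h
  obtain ⟨s, hs⟩ := hD (Set.range fun n : ℕ => n • x) (Set.range_nonempty _) ⟨y, by
    rintro _ ⟨n, rfl⟩
    exact h n⟩
  have : s ≤ s - x := hs.2 (by
    rintro _ ⟨n, rfl⟩
    have := hs.1 ⟨n + 1, rfl⟩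
    simp only [succ_nsmul] at this
    exact le_sub_iff_add_le.2 this)
  simpa using this

theorem IsArchimedean.lr (hD : IsArchimedean D) : IsArchimedean (Lr E D) := fun T S h x hx =>
  hD (T.1 x) (S.1 x) fun n => by simpa using h n x hx

/-- Positive parts suffice: `S ⊔ T = (S - T)⁺ + T` and `S ⊓ T = S - (S - T)⁺`. The order remains the
pointwise one. -/
noncomputable instance instLatticeLr [hD : Fact (IsOrderComplete D)] : Lattice (Lr E D) :=
  let pos (T : Lr E D) : Lr E D := (exists_isLUB_zero_of_isOrderComplete hD.out T).choose
  have hpos (T : Lr E D) : IsLUB {T, 0} (pos T) :=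
    (exists_isLUB_zero_of_isOrderComplete hD.out T).choose_spec.1
  { instPartialOrderLr with
    sup := fun S T => pos (S - T) + T
    inf := fun S T => S - pos (S - T)
    le_sup_left := fun S T => sub_le_iff_le_add.1 ((hpos (S - T)).1 (Set.mem_insert _ _))
    le_sup_right := fun S T =>
      le_add_of_nonneg_left ((hpos (S - T)).1 (Set.mem_insert_of_mem _ rfl))
    sup_le := fun S T U h h' => le_sub_iff_add_le.1 ((hpos (S - T)).2 (by
      rintro _ (rfl | rfl)
      · exact sub_le_sub_right h T
      · exact sub_nonneg.2 h'))
    inf_le_left := fun S T =>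
      sub_le_self _ ((hpos (S - T)).1 (Set.mem_insert_of_mem _ rfl))
    inf_le_right := fun S T => sub_le_comm.1 ((hpos (S - T)).1 (Set.mem_insert _ _))
    le_inf := fun S T U h h' => le_sub_comm.1 ((hpos (T - U)).2 (by
      rintro _ (rfl | rfl)
      · exact sub_le_sub_left h' T
      · exact sub_nonneg.2 h)) }

theorem isLUB_posPart_apply [hD : Fact (IsOrderComplete D)] (T : Lr E D) {x : E} (hx : 0 ≤ x) :
    IsLUB (T.1 '' Set.Icc 0 x) (T⁺.1 x) := by
  obtain ⟨P, hP, h⟩ := exists_isLUB_zero_of_isOrderComplete hD.out T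
  rw [posPart_def, isLUB_pair.unique hP]
  exact h x hx

end OrderComplete

theorem isRieszSpace_of_lattice {X : Type u} [AddCommGroup X] [Lattice X] [IsOrderedAddMonoid X]
    [Module ℝ X] [IsOrderedModule ℝ X] : IsRieszSpace X :=
  fun x y => ⟨⟨x ⊔ y, isLUB_pair⟩, ⟨x ⊓ y, isGLB_pair⟩⟩

/-! ### Pervasive subspaces of Archimedean Riesz spaces -/

section Density

variable {X : Type u} [AddCommGroup X] [Lattice X] [IsOrderedAddMonoid X] [Module ℝ X]
  [IsOrderedModule ℝ X]

/-- In an Archimedean Riesz space an element minorized by a pervasive subspace is the supremum of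
the elements of the subspace below it. -/
theorem IsPervasive.isLUB (hX : IsArchimedean X) {Y : Submodule ℝ X}
    (hY : IsPervasive (Y : Set X)) {x y₀ : X} (hy₀ : y₀ ∈ Y) (hle : y₀ ≤ x) :
    IsLUB {y | y ∈ (Y : Set X) ∧ y ≤ x} x := by
  refine ⟨fun y hy => hy.2, fun u hu => ?_⟩
  by_contra hxu
  have hpos : 0 < x - x ⊓ u := by
    rw [sub_pos]
    exact lt_of_le_of_ne inf_le_left fun h => hxu (inf_eq_left.1 h)
  obtain ⟨y, hy, hy0, hyx⟩ := hY _ hpos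
  -- Each `y₀ + n • y` below `x` is also below `u`, and `y` fits in the gap `x - x ⊓ u`, so one more
  -- `y` can be added; this contradicts the Archimedean property.
  have hn : ∀ n : ℕ, y₀ + n • y ≤ x := by
    intro n
    induction n with
    | zero => simpa using hle
    | succ n ih =>
      have hmem : y₀ + n • y ∈ Y := Y.add_mem hy₀ (Y.smul_of_tower_mem n hy)
      have h1 : y₀ + n • y ≤ x ⊓ u := le_inf ih (hu ⟨hmem, ih⟩)
      calc y₀ + (n + 1) • y = (y₀ + n • y) + y := by rw [succ_nsmul, add_assoc]
        _ ≤ x ⊓ u + (x - x ⊓ u) := add_le_add h1 hyx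
        _ = x := by abel
  exact hy0.not_ge (hX y (x - y₀) fun n => le_sub_iff_add_le'.2 (hn n))

theorem IsPervasive.isGLB (hX : IsArchimedean X) {Y : Submodule ℝ X}
    (hY : IsPervasive (Y : Set X)) {x y₀ : X} (hy₀ : y₀ ∈ Y) (hle : x ≤ y₀) :
    IsGLB {y | y ∈ (Y : Set X) ∧ x ≤ y} x := by
  have h := hY.isLUB hX (Y.neg_mem hy₀) (neg_le_neg hle)
  refine ⟨fun y hy => hy.2, fun u hu => ?_⟩
  refine neg_le_neg_iff.1 (h.2 fun y hy => ?_)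
  exact le_neg.1 (hu ⟨Y.neg_mem hy.1, le_neg.1 hy.2⟩)

end Density

/-! ### Disjointness through moduli -/

section Disjoint

variable {X : Type u} [AddCommGroup X] [Lattice X] [IsOrderedAddMonoid X]

theorem abs_add_sup_abs_sub_eq (a b : X) : |a + b| ⊔ |a - b| = |a| + |b| := by
  refine le_antisymm (sup_le (abs_add_le a b) ?_) ?_
  · rw [sub_eq_add_neg, ← abs_neg b]
    exact abs_add_le a (-b)
  · rw [← le_sub_iff_add_le]
    have h1 : ∀ c : X, c ≤ |a + b| ⊔ |a - b| - |b| ↔ |b| ≤ |a + b| ⊔ |a - b| - c := fun c => by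
      rw [le_sub_comm]
    refine abs_le'.2 ⟨?_, ?_⟩ <;> rw [h1] <;> refine abs_le'.2 ⟨?_, ?_⟩ <;> rw [le_sub_iff_add_le']
    · exact (le_abs_self _).trans le_sup_left
    · exact ((le_abs_self _).trans_eq' (by abel)).trans le_sup_right
    · exact ((neg_le_abs _).trans_eq' (by abel)).trans le_sup_right
    · exact ((neg_le_abs _).trans_eq' (by abel)).trans le_sup_left

/-- Disjointness gives `z + |b| = ||b| - z|`, which is below both `|z + b|` and `|z - b|`; both are
also at most `z + |b|`. -/
theorem abs_add_eq_abs_sub_of_inf_eq_zero {z b : X} (hz : 0 ≤ z) (h : z ⊓ |b| = 0) :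
    |z + b| = |z - b| := by
  have h0 : z + |b| = |(|b| - z)| := by
    have := two_nsmul_inf_eq_add_sub_abs_sub z |b|
    rw [h, smul_zero] at this
    exact sub_eq_zero.1 this.symm
  have hzabs : |z| = z := abs_of_nonneg hz
  have h1 : z + |b| ≤ |z + b| := by
    have := abs_abs_sub_abs_le b (-z)
    rwa [abs_neg, hzabs, ← h0, sub_neg_eq_add, add_comm b z] at this
  have h2 : z + |b| ≤ |z - b| := by
    have := abs_abs_sub_abs_le b z
    rwa [hzabs, ← h0, abs_sub_comm] at this
  have h3 := abs_add_sup_abs_sub_eq z b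
  rw [hzabs] at h3
  rw [le_antisymm (h3 ▸ le_sup_left) h1, le_antisymm (h3 ▸ le_sup_right) h2]

/-- The hypothesis forces `(z + b)⁺ = z + b⁺` and `(z + b)⁻ = b⁻`, and positive and negative parts
are disjoint. -/
theorem inf_negPart_eq_zero_of_abs_add_eq [Module ℝ X] {z b : X} (hz : 0 ≤ z)
    (h : |z + b| = z + |b|) : z ⊓ b⁻ = 0 := by
  have h1 : (z + b)⁺ = z + b⁺ := by
    have e1 := posPart_add_negPart (z + b)
    have e2 := posPart_sub_negPart (z + b)
    have e3 := posPart_add_negPart b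
    have e4 := posPart_sub_negPart b
    have : (2 : ℝ) • (z + b)⁺ = (2 : ℝ) • (z + b⁺) := by
      calc (2 : ℝ) • (z + b)⁺ = ((z + b)⁺ + (z + b)⁻) + ((z + b)⁺ - (z + b)⁻) := by module
        _ = (z + (b⁺ + b⁻)) + (z + (b⁺ - b⁻)) := by rw [e1, e2, h, e3, e4]
        _ = _ := by module
    exact smul_right_injective X (two_ne_zero' ℝ) this
  have h2 : (z + b)⁻ = b⁻ := by
    have e2 := posPart_sub_negPart (z + b)
    have e4 := posPart_sub_negPart b
    rw [h1] at e2
    have k2 := sub_sub_cancel (z + b⁺) (z + b)⁻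
    have k4 := sub_sub_cancel b⁺ b⁻
    rw [e2] at k2
    rw [e4] at k4
    rw [← k2, ← k4]
    abel
  have h3 := posPart_inf_negPart_eq_zero (z + b)
  rw [h1, h2] at h3
  refine le_antisymm ?_ (le_inf hz (negPart_nonneg _))
  rw [← h3]
  exact inf_le_inf_right _ (le_add_of_nonneg_right (posPart_nonneg _))

/-- Both moduli equal `z + |b|`, so `z` is disjoint from `b⁻` and from `b⁺`, hence from `|b|`, which
dominates it. -/
theorem eq_zero_of_abs_add_eq_abs_sub [Module ℝ X] {z b : X} (hz : 0 ≤ z) (hzb : z ≤ |b|)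
    (h : |z + b| = |z - b|) : z = 0 := by
  have h3 := abs_add_sup_abs_sub_eq z b
  rw [abs_of_nonneg hz] at h3
  have h1 : |z + b| = z + |b| := by rw [← h3, ← h, sup_idem]
  have h2 : |z + -b| = z + |(-b)| := by rw [← sub_eq_add_neg, ← h, h1, abs_neg]
  have k1 := inf_negPart_eq_zero_of_abs_add_eq hz h1
  have k2 := inf_negPart_eq_zero_of_abs_add_eq hz h2
  rw [negPart_neg] at k2
  have : z ≤ b⁻ + b⁺ := by rwa [add_comm, posPart_add_negPart]
  let _ : DistribLattice X := AddCommGroup.toDistribLattice X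
  have hsup : b⁺ ⊔ b⁻ = |b| := by
    have := posPart_inf_negPart_eq_zero b
    rw [← posPart_add_negPart, ← inf_add_sup, this, zero_add]
  have : z = z ⊓ (b⁺ ⊔ b⁻) := by rw [hsup, inf_eq_left.2 hzb]
  rw [this, inf_sup_left, k1, k2, sup_idem]

/-- If every modulus in `R` is the infimum of its majorants in the image of a bipositive map,
then disjointness of elements is disjointness of their images. -/
theorem isDisjoint_iff_abs {Z : Type v} [AddCommGroup Z] [PartialOrder Z] [IsOrderedAddMonoid Z]
    [Module ℝ Z] [Module ℝ X] (j : Z →ₗ[ℝ] X) (hj : IsBipositive j)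
    (hinf : ∀ x : Z, IsGLB {r | r ∈ Set.range j ∧ |j x| ≤ r} |j x|) (x y : Z) :
    IsDisjoint x y ↔ |j x + j y| = |j x - j y| := by
  have hmono : ∀ a b : Z, j a ≤ j b ↔ a ≤ b := fun a b => by
    rw [← sub_nonneg, ← map_sub, hj, sub_nonneg]
  have hub : ∀ a b : Z, b = -a → ∀ u : Z, u ∈ upperBounds {a, b} ↔ |j a| ≤ j u := by
    rintro a _ rfl u
    rw [abs_le', ← map_neg, hmono, hmono]
    simp [upperBounds]
  have hp := hub (x + y) (-x - y) (by abel)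
  have hm := hub (x - y) (-x + y) (by abel)
  rw [← map_add, ← map_sub, IsDisjoint, Set.ext_iff]
  constructor
  · intro h
    refine (hinf _).unique ?_
    have e : {r | r ∈ Set.range j ∧ |j (x + y)| ≤ r} = {r | r ∈ Set.range j ∧ |j (x - y)| ≤ r} := by
      ext r
      refine and_congr_right ?_
      rintro ⟨u, rfl⟩
      rw [← hp, ← hm, h]
    rw [e]
    exact hinf _
  · intro h u
    rw [hp, hm, h]

end Disjoint

/-! ### Bipositive maps with pervasive range -/

section Embedding

variable {F : Type v} [AddCommGroup F] [Lattice F] [IsOrderedAddMonoid F] [Module ℝ F]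
  {D : Type w} [AddCommGroup D] [Lattice D] [IsOrderedAddMonoid D] [Module ℝ D]

theorem IsBipositive.le_iff {X : Type u} {Z : Type v} [AddCommGroup X] [PartialOrder X]
    [IsOrderedAddMonoid X] [Module ℝ X] [AddCommGroup Z] [PartialOrder Z] [IsOrderedAddMonoid Z]
    [Module ℝ Z] {j : X →ₗ[ℝ] Z} (hj : IsBipositive j) {a b : X} : j a ≤ j b ↔ a ≤ b := by
  rw [← sub_nonneg, ← map_sub, hj, sub_nonneg]

theorem IsBipositive.injective {X : Type u} {Z : Type v} [AddCommGroup X] [PartialOrder X]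
    [IsOrderedAddMonoid X] [Module ℝ X] [AddCommGroup Z] [PartialOrder Z] [IsOrderedAddMonoid Z]
    [Module ℝ Z] {j : X →ₗ[ℝ] Z} (hj : IsBipositive j) : Function.Injective j :=
  fun _ _ h => le_antisymm (hj.le_iff.1 h.le) (hj.le_iff.1 h.ge)

/-- Existing suprema of pairs are preserved by a bipositive map with pervasive range. -/
theorem IsBipositive.isLUB_pair {X : Type u} [AddCommGroup X] [PartialOrder X]
    [IsOrderedAddMonoid X] [Module ℝ X] {j : X →ₗ[ℝ] D} (hj : IsBipositive j)
    (hp : IsPervasive (Set.range j)) {a b c : X} (h : IsLUB {a, b} c) : j a ⊔ j b = j c := by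
  have hle : j a ⊔ j b ≤ j c :=
    sup_le (hj.le_iff.2 (h.1 (Set.mem_insert _ _))) (hj.le_iff.2 (h.1 (Set.mem_insert_of_mem _ rfl)))
  by_contra hne
  -- If the supremum in `D` were strictly below `j c`, some `j y > 0` would fit in the gap and `c -
  -- y` would be a smaller upper bound.
  obtain ⟨_, ⟨y, rfl⟩, hy0, hy⟩ := hp _ (sub_pos.2 (lt_of_le_of_ne hle hne))
  have hsup : j a ⊔ j b ≤ j (c - y) := by
    rw [map_sub]
    exact le_sub_comm.1 hy
  have hc : c ≤ c - y := h.2 (by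
    rintro _ (rfl | rfl)
    · exact hj.le_iff.1 (le_sup_left.trans hsup)
    · exact hj.le_iff.1 (le_sup_right.trans hsup))
  have : j c ≤ j c - j y := by
    rw [← map_sub]
    exact hj.le_iff.2 hc
  exact hy0.not_ge (by simpa using this)

theorem IsBipositive.map_inf {j : F →ₗ[ℝ] D} (hj : IsBipositive j)
    (hp : IsPervasive (Set.range j)) (a b : F) : j (a ⊓ b) = j a ⊓ j b := by
  have h := hj.isLUB_pair hp (a := -a) (b := -b) (c := -a ⊔ -b) _root_.isLUB_pair
  rw [← neg_inf, map_neg, map_neg, map_neg, ← neg_inf, neg_inj] at h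
  exact h.symm

/-- Infima equal to zero are preserved by a bipositive map with pervasive range. -/
theorem IsBipositive.isGLB_image {j : F →ₗ[ℝ] D} (hj : IsBipositive j)
    (hp : IsPervasive (Set.range j)) {s : Set F} (hs : IsGLB s 0) : IsGLB (j '' s) 0 := by
  refine ⟨?_, fun w hw => ?_⟩
  · rintro _ ⟨y, hy, rfl⟩
    exact (hj y).2 (hs.1 hy)
  · by_contra hw0
    have hpos : 0 < w ⊔ 0 := lt_of_le_of_ne le_sup_right fun h => hw0 (sup_eq_right.1 h.symm)
    obtain ⟨_, ⟨y, rfl⟩, hy0, hy⟩ := hp _ hpos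
    have : y ≤ 0 := hs.2 fun z hz => hj.le_iff.1 (hy.trans (sup_le (hw ⟨z, hz, rfl⟩)
      ((hj z).2 (hs.1 hz))))
    rw [← hj.le_iff, map_zero] at this
    exact hy0.not_ge this

end Embedding

/-! ### Order continuity of positive operators through decreasing sets -/

section PreservesInf

variable {E : Type u} {D : Type v} [AddCommGroup E] [Lattice E] [IsOrderedAddMonoid E]
  [Module ℝ E] [AddCommGroup D] [PartialOrder D] [IsOrderedAddMonoid D] [Module ℝ D]

/-- Sets that decrease to `0` are mapped to sets with infimum `0`. -/
def PreservesInfZero (U : E →ₗ[ℝ] D) : Prop :=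
  ∀ s : Set E, s.Nonempty → DirectedOn (· ≥ ·) s → IsGLB s 0 → IsGLB (U '' s) 0

variable [IsOrderedModule ℝ E] [IsOrderedModule ℝ D]

theorem preservesInfZero_of_nonneg {U : Lr E D} (hU : 0 ≤ U)
    (h : ∀ s : Set E, s.Nonempty → DirectedOn (· ≥ ·) s → IsGLB s 0 →
      ∀ w, (∀ b ∈ s, w ≤ U.1 b) → w ≤ 0) : PreservesInfZero U.1 := by
  refine fun s hs hdir hglb => ⟨?_, fun w hw => h s hs hdir hglb w fun b hb => hw ⟨b, hb, rfl⟩⟩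
  rintro _ ⟨b, hb, rfl⟩
  exact hU b (hglb.1 hb)

theorem PreservesInfZero.mono {U V : Lr E D} (hV : 0 ≤ V) (hVU : V ≤ U)
    (hU : PreservesInfZero U.1) : PreservesInfZero V.1 :=
  preservesInfZero_of_nonneg hV fun s hs hdir hglb w hw => (hU s hs hdir hglb).2 (by
    rintro _ ⟨b, hb, rfl⟩
    exact (hw b hb).trans (hVU b (hglb.1 hb)))

theorem PreservesInfZero.add {U V : Lr E D} (hU0 : 0 ≤ U) (hV0 : 0 ≤ V)
    (hU : PreservesInfZero U.1) (hV : PreservesInfZero V.1) : PreservesInfZero (U + V).1 := by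
  refine preservesInfZero_of_nonneg (add_nonneg hU0 hV0) fun s hs hdir hglb w hw => ?_
  refine (hV s hs hdir hglb).2 ?_
  rintro _ ⟨b', hb', rfl⟩
  rw [← sub_nonpos]
  refine (hU s hs hdir hglb).2 ?_
  rintro _ ⟨b, hb, rfl⟩
  obtain ⟨c, hc, hcb, hcb'⟩ := hdir b hb b' hb'
  rw [sub_le_iff_le_add]
  exact (hw c hc).trans (add_le_add (Lr.mono hU0 hcb) (Lr.mono hV0 hcb'))

theorem PreservesInfZero.smul {U : Lr E D} {c : ℝ} (hc : 0 ≤ c)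
    (hU : PreservesInfZero U.1) : PreservesInfZero (c • U).1 := by
  rcases hc.eq_or_lt with rfl | hc
  · intro s hs _ _
    have : (((0 : ℝ) • U).1 : E → D) '' s = {0} := by
      rw [zero_smul]
      exact hs.image_const 0
    rw [this]
    exact isGLB_singleton
  · intro s hs hdir hglb
    have h := (OrderIso.isGLB_image' (OrderIso.smulRight (β := D) hc)).2 (hU s hs hdir hglb)
    simpa [Set.image_image] using h

/-- Order continuity passes to pointwise suprema of directed families. -/
theorem PreservesInfZero.of_isLUB {𝒰 : Set (Lr E D)} {U : Lr E D} (hU0 : 0 ≤ U)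
    (hU : IsLUB 𝒰 U)
    (hpt : ∀ x : E, 0 ≤ x → IsLUB ((fun V : Lr E D => V.1 x) '' 𝒰) (U.1 x))
    (h : ∀ V ∈ 𝒰, 0 ≤ V ∧ PreservesInfZero V.1) : PreservesInfZero U.1 := by
  refine preservesInfZero_of_nonneg hU0 fun s hs hdir hglb w hw => ?_
  obtain ⟨b₀, hb₀⟩ := hs
  -- For each `V`, and `c` in `s` below `b` and `b₀`, `w ≤ V c + (U - V) c ≤ V b + (U - V) b₀`. The
  -- infimum over `b` gives `w ≤ U b₀ - V b₀`; then take the supremum over `V`.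
  have : U.1 b₀ ≤ U.1 b₀ - w := (hpt b₀ (hglb.1 hb₀)).2 (by
    rintro _ ⟨V, hV, rfl⟩
    have hUV : (0 : Lr E D) ≤ U - V := sub_nonneg.2 (hU.1 hV)
    have hw' : w - (U - V).1 b₀ ≤ 0 := ((h V hV).2 s ⟨b₀, hb₀⟩ hdir hglb).2 (by
      rintro _ ⟨b, hb, rfl⟩
      obtain ⟨c, hc, hcb, hcb₀⟩ := hdir b hb b₀ hb₀
      rw [sub_le_iff_le_add]
      calc w ≤ U.1 c := hw c hc
        _ = V.1 c + (U - V).1 c := by simp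
        _ ≤ _ := add_le_add (Lr.mono (h V hV).1 hcb) (Lr.mono hUV hcb₀))
    have e : (U - V).1 b₀ = U.1 b₀ - V.1 b₀ := by simp
    rw [sub_nonpos, e] at hw'
    exact le_sub_comm.1 hw')
  simpa using this

end PreservesInf

/-! ### Order continuity of an operator and of its modulus -/

section OrderContinuous

variable {E : Type u} [AddCommGroup E] [Lattice E] [IsOrderedAddMonoid E] [Module ℝ E]
  [IsOrderedModule ℝ E]
  {F : Type v} [AddCommGroup F] [Lattice F] [IsOrderedAddMonoid F] [Module ℝ F]
  [IsOrderedModule ℝ F]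
  {D : Type w} [AddCommGroup D] [Lattice D] [IsOrderedAddMonoid D] [Module ℝ D]
  [IsOrderedModule ℝ D]

theorem IsOrderContinuous.neg {T : E →ₗ[ℝ] F} (hT : IsOrderContinuous T) :
    IsOrderContinuous (-T) := by
  intro A _ _ _ x hx
  obtain ⟨Γ, i1, i2, i3, b, h1, h2, h3⟩ := hT A x hx
  refine ⟨Γ, i1, i2, i3, b, h1, h2, ?_⟩
  simpa using h3

theorem abs_apply_le [Fact (IsOrderComplete D)] (U : Lr E D) (x : E) :
    |U.1 x| ≤ (|U|).1 |x| := by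
  have h1 : ∀ z : E, 0 ≤ z → U.1 z ≤ (|U|).1 z := le_abs_self U
  have h2 : ∀ z : E, 0 ≤ z → -U.1 z ≤ (|U|).1 z := neg_le_abs U
  have e : U.1 x = U.1 x⁺ - U.1 x⁻ := by rw [← map_sub, posPart_sub_negPart]
  have e' : (|U|).1 |x| = (|U|).1 x⁺ + (|U|).1 x⁻ := by rw [← map_add, posPart_add_negPart]
  rw [e', abs_le', e]
  constructor
  · rw [sub_eq_add_neg]
    exact add_le_add (h1 _ (posPart_nonneg _)) (h2 _ (negPart_nonneg _))
  · rw [neg_sub, sub_eq_neg_add]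
    exact add_le_add (h2 _ (posPart_nonneg _)) (h1 _ (negPart_nonneg _))

/-- Composition of regular operators with a positive embedding. -/
def compLr (E : Type u) [AddCommGroup E] [Lattice E] [IsOrderedAddMonoid E] [Module ℝ E]
    (i : F →ₗ[ℝ] D) (hi : IsBipositive i) : Lr E F →ₗ[ℝ] Lr E D where
  toFun T := ⟨i ∘ₗ T.1, by
    obtain ⟨T, A, B, hA, hB, rfl⟩ := T
    exact ⟨i ∘ₗ A, i ∘ₗ B, fun x hx => (hi _).2 (hA x hx), fun x hx => (hi _).2 (hB x hx),
      LinearMap.comp_sub _ _ _⟩⟩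
  map_add' S T := Subtype.ext (LinearMap.comp_add S.1 T.1 i)
  map_smul' c T := Subtype.ext (LinearMap.comp_smul i c T.1)

@[simp]
theorem compLr_apply (i : F →ₗ[ℝ] D) (hi : IsBipositive i) (T : Lr E F) (x : E) :
    (compLr E i hi T).1 x = i (T.1 x) := rfl

theorem compLr_bipositive (i : F →ₗ[ℝ] D) (hi : IsBipositive i) :
    IsBipositive (compLr E i hi) :=
  fun T => forall₂_congr fun x _ => hi (T.1 x)

/-- A bipositive `i` is an order isomorphism of `F` onto its range, so positive decompositions
transfer both ways. -/
theorem range_compLr (i : F →ₗ[ℝ] D) (hi : IsBipositive i) :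
    Set.range (compLr E i hi) = LrInto E (LinearMap.range i) := by
  let e : F ≃ₗ[ℝ] LinearMap.range i := LinearEquiv.ofInjective i hi.injective
  have he : ∀ y : F, ((e y : LinearMap.range i) : D) = i y := fun y => rfl
  have he' : ∀ z : LinearMap.range i, i (e.symm z) = z := fun z => by
    rw [← he, LinearEquiv.apply_symm_apply]
  ext T
  constructor
  · rintro ⟨T, rfl⟩
    obtain ⟨T, A, B, hA, hB, rfl⟩ := T
    refine ⟨⟨(e : F →ₗ[ℝ] LinearMap.range i) ∘ₗ (A - B), (e : F →ₗ[ℝ] LinearMap.range i) ∘ₗ A,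
      (e : F →ₗ[ℝ] LinearMap.range i) ∘ₗ B, fun x hx => (hi _).2 (hA x hx),
      fun x hx => (hi _).2 (hB x hx), LinearMap.comp_sub _ _ _⟩, fun x => rfl⟩
  · rintro ⟨⟨R, A, B, hA, hB, rfl⟩, hR⟩
    have hpos : ∀ z : LinearMap.range i, 0 ≤ z → 0 ≤ e.symm z := fun z hz => by
      rw [← hi, he']
      exact hz
    refine ⟨⟨(e.symm : LinearMap.range i →ₗ[ℝ] F) ∘ₗ (A - B),
      (e.symm : LinearMap.range i →ₗ[ℝ] F) ∘ₗ A, (e.symm : LinearMap.range i →ₗ[ℝ] F) ∘ₗ B,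
      fun x hx => hpos _ (hA x hx), fun x hx => hpos _ (hB x hx), LinearMap.comp_sub _ _ _⟩, ?_⟩
    refine Subtype.ext (LinearMap.ext fun x => ?_)
    rw [hR x]
    exact he' _

theorem IsOrderContinuous.preservesInfZero_posPart [Fact (IsOrderComplete D)]
    {i : F →ₗ[ℝ] D} (hi : IsBipositive i) (hp : IsPervasive (Set.range i)) {T : Lr E F}
    (hT : IsOrderContinuous T.1) : PreservesInfZero ((compLr E i hi T)⁺).1 := by
  set P := (compLr E i hi T)⁺ with hP
  have hP0 : 0 ≤ P := posPart_nonneg _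
  have hTP : ∀ x : E, 0 ≤ x → i (T.1 x) ≤ P.1 x := le_posPart (compLr E i hi T)
  refine preservesInfZero_of_nonneg hP0 fun s hs hdir hglb w hw => ?_
  obtain ⟨β, hβ⟩ := hs
  -- By the formula for `P β` it suffices that `w ≤ P β - i (T y)` whenever `0 ≤ y ≤ β`. The net `y
  -- ⊓ b`, with `b` decreasing in `s`, tends to `0`, so order continuity controls `T (y ⊓ b)`.
  have : P.1 β ≤ P.1 β - w := (isLUB_posPart_apply (compLr E i hi T) (hglb.1 hβ)).2 (by
    rintro _ ⟨y, ⟨hy0, hyβ⟩, rfl⟩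
    have : Nonempty (↥s)ᵒᵈ := ⟨OrderDual.toDual ⟨β, hβ⟩⟩
    have hd : IsDirected (↥s)ᵒᵈ (· ≤ ·) := ⟨fun a b => by
      obtain ⟨c, hc, hca, hcb⟩ := hdir _ (OrderDual.ofDual a).2 _ (OrderDual.ofDual b).2
      exact ⟨OrderDual.toDual ⟨c, hc⟩, hca, hcb⟩⟩
    obtain ⟨Γ, _, _, _, c, -, hc, hlim⟩ := hT (↥s)ᵒᵈ
      (fun b => y ⊓ (OrderDual.ofDual b : ↥s)) ⟨(↥s)ᵒᵈ, inferInstance, inferInstance, hd,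
        fun b => ((OrderDual.ofDual b : ↥s) : E), fun a b h => h, by
          convert hglb
          ext z
          exact ⟨fun ⟨b, hb⟩ => hb ▸ (OrderDual.ofDual b).2, fun hz => ⟨OrderDual.toDual ⟨z, hz⟩, rfl⟩⟩,
        fun γ => ⟨γ, fun α hα => by
          have h0 : 0 ≤ y ⊓ ((OrderDual.ofDual α : ↥s) : E) :=
            le_inf hy0 (hglb.1 (OrderDual.ofDual α).2)
          rw [sub_zero, abs_of_nonneg h0]
          exact inf_le_right.trans hα⟩⟩
    rw [compLr_apply, le_sub_comm, ← sub_nonpos]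
    refine (hi.isGLB_image hp hc).2 ?_
    rintro _ ⟨_, ⟨γ, rfl⟩, rfl⟩
    obtain ⟨b₀, hb₀⟩ := hlim γ
    obtain ⟨b, hb, hbb₀, hbβ⟩ := hdir _ (OrderDual.ofDual b₀).2 β hβ
    have h1 : i (T.1 (y ⊓ b)) ≤ i (c γ) := by
      have := hb₀ (OrderDual.toDual ⟨b, hb⟩) hbb₀
      rw [sub_zero] at this
      exact hi.le_iff.2 ((le_abs_self _).trans this)
    -- For `b ≤ β` the remainder satisfies `y - y ⊓ b ≤ β - b`, so its image costs at most `P β - P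
    -- b`.
    have h2 : i (T.1 (y - y ⊓ b)) ≤ P.1 (β - b) := by
      refine (hTP _ (sub_nonneg.2 inf_le_left)).trans (Lr.mono hP0 ?_)
      rw [sub_le_comm]
      refine le_inf (sub_le_self _ (sub_nonneg.2 hbβ)) ?_
      rw [sub_le_comm]
      exact sub_le_sub_right hyβ b
    have h3 := hw b hb
    rw [map_sub, map_sub, map_sub] at h2
    rw [sub_le_iff_le_add]
    calc w ≤ P.1 b := h3
      _ = P.1 β - (P.1 β - P.1 b) := by abel
      _ ≤ P.1 β - (i (T.1 y) - i (T.1 (y ⊓ b))) := sub_le_sub_left h2 _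
      _ = i (T.1 (y ⊓ b)) + (P.1 β - i (T.1 y)) := by abel
      _ ≤ _ := add_le_add_left h1 _)
  simpa using this

/-- A regular operator is order continuous if and only if its modulus in the space of operators
into an order completion of the codomain is. -/
theorem isOrderContinuous_iff [hD : Fact (IsOrderComplete D)]
    {i : F →ₗ[ℝ] D} (hi : IsBipositive i) (hp : IsPervasive (Set.range i))
    (hm : IsMajorizing (Set.range i)) (T : Lr E F) :
    IsOrderContinuous T.1 ↔ PreservesInfZero (|compLr E i hi T|).1 := by
  constructor
  · intro hT
    have hneg : IsOrderContinuous (-T).1 := hT.neg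
    have h2 := hneg.preservesInfZero_posPart hi hp
    rw [map_neg, posPart_neg] at h2
    rw [← posPart_add_negPart]
    exact (hT.preservesInfZero_posPart hi hp).add (posPart_nonneg _) (negPart_nonneg _) h2
  · intro hQ A _ _ _ x hx
    obtain ⟨Γ, _, ⟨γ₀⟩, hΓ, b, hanti, hb, hlim⟩ := hx
    set Q := |compLr E i hi T|
    have hQ0 : 0 ≤ Q := abs_nonneg _
    have hb0 : ∀ γ, 0 ≤ b γ := fun γ => hb.1 ⟨γ, rfl⟩
    have hQb : IsGLB (Q.1 '' Set.range b) 0 := by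
      refine hQ _ ⟨_, γ₀, rfl⟩ ?_ hb
      rintro _ ⟨γ, rfl⟩ _ ⟨γ', rfl⟩
      obtain ⟨δ, h, h'⟩ := hΓ.directed γ γ'
      exact ⟨_, ⟨δ, rfl⟩, hanti h, hanti h'⟩
    -- The bounds `Q (b γ)` lie in `D`, not in `F`. Their majorants from `F` serve as the dominating
    -- net: they are directed because `i` preserves infima, and density makes their infimum `0`.
    let C : Set F := {c | ∃ γ, Q.1 (b γ) ≤ i c}
    have hdir : IsDirected (↥C)ᵒᵈ (· ≤ ·) := ⟨by
      intro a a'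
      obtain ⟨γ, h⟩ := (OrderDual.ofDual a).2
      obtain ⟨γ', h'⟩ := (OrderDual.ofDual a').2
      obtain ⟨δ, hδ, hδ'⟩ := hΓ.directed γ γ'
      refine ⟨OrderDual.toDual ⟨(OrderDual.ofDual a).1 ⊓ (OrderDual.ofDual a').1, δ, ?_⟩,
        inf_le_left (a := (OrderDual.ofDual a).1), inf_le_right (a := (OrderDual.ofDual a).1)⟩
      rw [hi.map_inf hp]
      exact le_inf ((Lr.mono hQ0 (hanti hδ)).trans h) ((Lr.mono hQ0 (hanti hδ')).trans h')⟩
    have hne : Nonempty (↥C)ᵒᵈ := by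
      obtain ⟨_, ⟨c, rfl⟩, hc⟩ := hm (Q.1 (b γ₀))
      exact ⟨OrderDual.toDual ⟨c, γ₀, hc⟩⟩
    refine ⟨(↥C)ᵒᵈ, inferInstance, hne, hdir, fun c => ((OrderDual.ofDual c : ↥C) : F),
      fun a a' h => h, ⟨?_, fun w hw => ?_⟩, fun c => ?_⟩
    · rintro _ ⟨c, rfl⟩
      obtain ⟨γ, h⟩ := (OrderDual.ofDual c).2
      exact (hi _).1 ((hQ0 _ (hb0 γ)).trans h)
    · rw [← hi.le_iff, map_zero]
      refine hQb.2 ?_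
      rintro _ ⟨_, ⟨γ, rfl⟩, rfl⟩
      obtain ⟨y₀, hy₀, hle⟩ := hm (Q.1 (b γ))
      have hp' : IsPervasive ((LinearMap.range i : Submodule ℝ D) : Set D) := by
        rwa [LinearMap.coe_range]
      refine (hp'.isGLB hD.out.isArchimedean (by simpa using hy₀) hle).2 ?_
      rintro _ ⟨⟨c, rfl⟩, hc⟩
      exact hi.le_iff.2 (hw ⟨OrderDual.toDual ⟨c, γ, hc⟩, rfl⟩)
    · obtain ⟨γ, h⟩ := (OrderDual.ofDual c).2
      obtain ⟨α₀, hα₀⟩ := hlim γ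
      refine ⟨α₀, fun α hα => ?_⟩
      have h1 := hα₀ α hα
      rw [sub_zero] at h1 ⊢
      have h2 := ((abs_apply_le (compLr E i hi T) (x α)).trans (Lr.mono hQ0 h1)).trans h
      rw [compLr_apply] at h2
      refine abs_le'.2 ⟨hi.le_iff.1 ((le_abs_self _).trans h2), hi.le_iff.1 ?_⟩
      rw [map_neg]
      exact (neg_le_abs _).trans h2

end OrderContinuous

/-! ### Generated Riesz subspaces and bands of pervasively embedded spaces -/

section RieszCompletion

variable {R : Type w} [AddCommGroup R] [Lattice R] [IsOrderedAddMonoid R] [Module ℝ R]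
  [IsOrderedModule ℝ R]

theorem isRieszSubspace_rieszSubspaceGenerated (Y : Set R) :
    IsRieszSubspace (rieszSubspaceGenerated Y) := by
  intro x hx y hy z hz
  rw [rieszSubspaceGenerated, Submodule.mem_sInf] at hx hy ⊢
  exact fun S hS => hS.1 x (hx S hS) y (hy S hS) z hz

theorem subset_rieszSubspaceGenerated (Y : Set R) :
    Y ⊆ (rieszSubspaceGenerated Y : Set R) := by
  intro x hx
  rw [rieszSubspaceGenerated, SetLike.mem_coe, Submodule.mem_sInf]
  exact fun S hS => hS.2 hx

theorem rieszSubspaceGenerated_le {Y : Set R} {S : Submodule ℝ R} (hS : IsRieszSubspace S)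
    (hY : Y ⊆ (S : Set R)) : rieszSubspaceGenerated Y ≤ S :=
  sInf_le ⟨hS, hY⟩

theorem IsRieszSubspace.sup_mem {S : Submodule ℝ R} (hS : IsRieszSubspace S) {x y : R}
    (hx : x ∈ S) (hy : y ∈ S) : x ⊔ y ∈ S :=
  hS x hx y hy _ isLUB_pair

theorem IsRieszSubspace.inf_mem {S : Submodule ℝ R} (hS : IsRieszSubspace S) {x y : R}
    (hx : x ∈ S) (hy : y ∈ S) : x ⊓ y ∈ S := by
  have := S.neg_mem (hS.sup_mem (S.neg_mem hx) (S.neg_mem hy))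
  rwa [← neg_inf, neg_neg] at this

theorem IsRieszSubspace.isRieszSpace {S : Submodule ℝ R} (hS : IsRieszSubspace S) :
    IsRieszSpace S := by
  intro x y
  refine ⟨⟨⟨x ⊔ y, hS.sup_mem x.2 y.2⟩, ?_, fun u hu => ?_⟩,
    ⟨⟨x ⊓ y, hS.inf_mem x.2 y.2⟩, ?_, fun u hu => ?_⟩⟩
  · rintro _ (rfl | rfl)
    · exact le_sup_left (a := (_ : R))
    · exact le_sup_right (a := (_ : R))
  · exact sup_le (α := R) (hu (Set.mem_insert _ _)) (hu (Set.mem_insert_of_mem _ rfl))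
  · rintro _ (rfl | rfl)
    · exact inf_le_left (a := (_ : R))
    · exact inf_le_right (a := (_ : R))
  · exact le_inf (α := R) (hu (Set.mem_insert _ _)) (hu (Set.mem_insert_of_mem _ rfl))

theorem abs_smul_le (c : ℝ) (x : R) : |c • x| ≤ |c| • |x| := by
  have key : ∀ c : ℝ, ∀ x : R, c • x ≤ |c| • |x| := by
    intro c x
    rcases le_total 0 c with hc | hc
    · rw [abs_of_nonneg hc]
      exact smul_le_smul_of_nonneg_left (le_abs_self x) hc
    · rw [abs_of_nonpos hc, ← neg_smul_neg]
      exact smul_le_smul_of_nonneg_left (neg_le_abs x) (neg_nonneg.2 hc)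
  refine abs_le'.2 ⟨key c x, ?_⟩
  rw [← smul_neg, ← abs_neg x]
  exact key c (-x)

/-- The elements whose modulus is majorized by a given subspace form a Riesz subspace. -/
theorem exists_abs_le_of_mem_rieszSubspaceGenerated {Y : Submodule ℝ R}
    (hY : ∀ y ∈ Y, ∃ y' ∈ Y, |y| ≤ y') {x : R} (hx : x ∈ rieszSubspaceGenerated (Y : Set R)) :
    ∃ y ∈ Y, |x| ≤ y := by
  let M : Submodule ℝ R :=
    { carrier := {r | ∃ y ∈ Y, |r| ≤ y}
      zero_mem' := ⟨0, Y.zero_mem, by simp⟩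
      add_mem' := by
        rintro a b ⟨y, hy, h⟩ ⟨y', hy', h'⟩
        exact ⟨y + y', Y.add_mem hy hy', (abs_add_le a b).trans (add_le_add h h')⟩
      smul_mem' := by
        rintro c a ⟨y, hy, h⟩
        exact ⟨|c| • y, Y.smul_mem _ hy, (abs_smul_le c a).trans
          (smul_le_smul_of_nonneg_left h (abs_nonneg c))⟩ }
  have hM : IsRieszSubspace M := by
    rintro a ⟨y, hy, h⟩ b ⟨y', hy', h'⟩ z hz
    rw [hz.unique isLUB_pair]
    have h0 : 0 ≤ y := (abs_nonneg a).trans h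
    have h0' : 0 ≤ y' := (abs_nonneg b).trans h'
    refine ⟨y + y', Y.add_mem hy hy', abs_le'.2 ⟨sup_le ?_ ?_, ?_⟩⟩
    · exact ((le_abs_self a).trans h).trans (le_add_of_nonneg_right h0')
    · exact ((le_abs_self b).trans h').trans (le_add_of_nonneg_left h0)
    · exact (neg_le_neg le_sup_left).trans
        (((neg_le_abs a).trans h).trans (le_add_of_nonneg_right h0'))
  exact rieszSubspaceGenerated_le hM (fun y hy => hY y hy) hx

/-- A pervasive bipositive map into an Archimedean Riesz space restricts to a Riesz completion. -/
theorem isRieszCompletion_codRestrict (hR : IsArchimedean R) {X : Type u} [AddCommGroup X]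
    [PartialOrder X] [IsOrderedAddMonoid X] [Module ℝ X] [IsOrderedModule ℝ X]
    (j : X →ₗ[ℝ] R) (hj : IsBipositive j) (hp : IsPervasive (Set.range j))
    (hmaj : ∀ x, ∃ y, |j x| ≤ j y) {Y : Set R} (hY : Set.range j = Y) :
    IsRieszCompletion (j.codRestrict (rieszSubspaceGenerated Y)
      fun x => subset_rieszSubspaceGenerated Y (hY ▸ Set.mem_range_self x)) := by
  subst hY
  have hS := isRieszSubspace_rieszSubspaceGenerated (Set.range j)
  have hp' : IsPervasive ((LinearMap.range j : Submodule ℝ R) : Set R) := by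
    rwa [LinearMap.coe_range]
  refine ⟨hS.isRieszSpace, hj, fun s => ?_, ?_⟩
  · obtain ⟨y, hy, hle⟩ := exists_abs_le_of_mem_rieszSubspaceGenerated
      (Y := LinearMap.range j) (x := (s : R)) (by
        rintro _ ⟨x, rfl⟩
        obtain ⟨y, h⟩ := hmaj x
        exact ⟨_, ⟨y, rfl⟩, h⟩) (by rw [LinearMap.coe_range]; exact s.2)
    have h1 := hp'.isLUB hR (neg_mem hy) (neg_le.1 ((neg_le_abs _).trans hle))
    have h2 := hp'.isGLB hR hy ((le_abs_self _).trans hle)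
    refine ⟨⟨fun y hy => hy.2, fun u hu => h1.2 ?_⟩, ⟨fun y hy => hy.2, fun u hu => h2.2 ?_⟩⟩
    · rintro _ ⟨⟨x, rfl⟩, hx⟩
      exact hu ⟨⟨x, rfl⟩, hx⟩
    · rintro _ ⟨⟨x, rfl⟩, hx⟩
      exact hu ⟨⟨x, rfl⟩, hx⟩
  · rw [eq_top_iff]
    refine le_sInf ?_
    rintro K ⟨hK, hjK⟩ s -
    -- Generation inside the subspace reduces to generation in `R`: a supremum in `R` of two members
    -- of the subspace stays in it and is their supremum there.
    have hKmap : IsRieszSubspace (K.map (rieszSubspaceGenerated (Set.range j)).subtype) := by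
      rintro _ ⟨a, ha, rfl⟩ _ ⟨b, hb, rfl⟩ z hz
      have hzS := hS _ a.2 _ b.2 z hz
      refine ⟨⟨z, hzS⟩, hK a ha b hb _ ⟨?_, fun u hu => hz.2 ?_⟩, rfl⟩
      · rintro _ (rfl | rfl)
        · exact hz.1 (Set.mem_insert _ _)
        · exact hz.1 (Set.mem_insert_of_mem _ rfl)
      · rintro _ (rfl | rfl)
        · exact hu (Set.mem_insert _ _)
        · exact hu (Set.mem_insert_of_mem _ rfl)
    obtain ⟨t, ht, hts⟩ := rieszSubspaceGenerated_le (Y := Set.range j) hKmap (by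
      rintro _ ⟨x, rfl⟩
      exact ⟨_, hjK ⟨x, rfl⟩, rfl⟩) s.2
    rwa [← Subtype.ext hts]

/-- The elements whose modulus in `R` belongs to (the positive part of) a projection band of `R`
form a band of a pervasively embedded space. -/
theorem isBand_setOf_abs_mem {X : Type u} [AddCommGroup X]
    [PartialOrder X] [IsOrderedAddMonoid X] [Module ℝ X]
    (j : X →ₗ[ℝ] R) (hj : IsBipositive j) (hp : IsPervasive (Set.range j))
    (hinf : ∀ x : X, IsGLB {r | r ∈ Set.range j ∧ |j x| ≤ r} |j x|) (N : Set R)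
    (hzero : 0 ∈ N) (hsolid : ∀ a ∈ N, ∀ b, 0 ≤ b → b ≤ a → b ∈ N)
    (hadd : ∀ a ∈ N, ∀ b ∈ N, 0 ≤ a → 0 ≤ b → a + b ∈ N)
    (hsmul : ∀ c : ℝ, 0 ≤ c → ∀ a ∈ N, c • a ∈ N)
    (hproj : ∀ a, 0 ≤ a → ∃ u ∈ N, IsLUB {n | n ∈ N ∧ 0 ≤ n ∧ n ≤ a} u) :
    IsBand {x : X | |j x| ∈ N} := by
  have hdisj := isDisjoint_iff_abs j hj hinf
  refine ⟨⟨⟨⟨⟨{x : X | |j x| ∈ N}, ?_⟩, ?_⟩, ?_⟩, rfl⟩, Set.Subset.antisymm ?_ ?_⟩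
  · intro x y hx hy
    refine hsolid _ (hadd _ hx _ hy (abs_nonneg _) (abs_nonneg _)) _ (abs_nonneg _) ?_
    rw [map_add]
    exact abs_add_le _ _
  · simpa using hzero
  · intro c x hx
    refine hsolid _ (hsmul _ (abs_nonneg c) _ hx) _ (abs_nonneg _) ?_
    rw [map_smul]
    exact abs_smul_le _ _
  · intro t ht
    obtain ⟨u, huN, hu⟩ := hproj |j t| (abs_nonneg _)
    have hu0 : 0 ≤ u := hu.1 ⟨hzero, le_rfl, abs_nonneg _⟩
    have hut : u ≤ |j t| := hu.2 fun n hn => hn.2.2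
    by_cases heq : u = |j t|
    · change |j t| ∈ N
      rwa [← heq]
    -- If `u`, the largest element of `N` below `|j t|`, is not `|j t|`, pervasiveness puts `j z >
    -- 0` in the gap.
    obtain ⟨_, ⟨z, rfl⟩, hz0, hz⟩ := hp _ (sub_pos.2 (lt_of_le_of_ne hut heq))
    have hzd : z ∈ disjointComplement {x : X | |j x| ∈ N} := by
      intro b hb
      rw [hdisj]
      refine abs_add_eq_abs_sub_of_inf_eq_zero hz0.le ?_
      have hn0 : 0 ≤ j z ⊓ |j b| := le_inf hz0.le (abs_nonneg _)
      have hnN : j z ⊓ |j b| ∈ N := hsolid _ hb _ hn0 inf_le_right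
      -- Maximality of `u` makes `j z ⊓ |j b|` zero, so `z` lies in the disjoint complement; then
      -- `t` is disjoint from `z` although `j z ≤ |j t|`.
      have : u + j z ⊓ |j b| ≤ u := hu.1 ⟨hadd _ huN _ hnN hu0 hn0, add_nonneg hu0 hn0,
        le_sub_iff_add_le'.1 (inf_le_left.trans hz)⟩
      exact le_antisymm (by simpa using this) hn0
    have h := (hdisj _ _).1 (ht z hzd)
    rw [add_comm, abs_sub_comm] at h
    exact absurd (eq_zero_of_abs_add_eq_abs_sub hz0.le (hz.trans (sub_le_self _ hu0)) h) hz0.ne'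
  · intro x hx y hy
    have h := (hdisj _ _).1 (hy x hx)
    rw [add_comm, abs_sub_comm] at h
    exact (hdisj _ _).2 h

end RieszCompletion

/-! ### The largest order continuous part of a positive operator -/

section OrderContinuousBand

variable {E : Type u} {D : Type v} [AddCommGroup E] [Lattice E] [IsOrderedAddMonoid E]
  [Module ℝ E] [IsOrderedModule ℝ E] [AddCommGroup D] [Lattice D] [IsOrderedAddMonoid D]
  [Module ℝ D] [IsOrderedModule ℝ D]

/-- Every positive operator has a largest order continuous part. -/
theorem exists_isLUB_preservesInfZero [hD : Fact (IsOrderComplete D)] {A : Lr E D} (hA : 0 ≤ A) :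
    ∃ U : Lr E D, PreservesInfZero U.1 ∧
      IsLUB {V : Lr E D | PreservesInfZero V.1 ∧ 0 ≤ V ∧ V ≤ A} U := by
  have hzero : PreservesInfZero (0 : Lr E D).1 :=
    preservesInfZero_of_nonneg le_rfl fun s ⟨b, hb⟩ _ _ w hw => hw b hb
  have hdir : DirectedOn (· ≤ ·) {V : Lr E D | PreservesInfZero V.1 ∧ 0 ≤ V ∧ V ≤ A} := by
    intro V hV V' hV'
    have h0 : 0 ≤ V ⊔ V' := hV.2.1.trans le_sup_left
    have hle : V ⊔ V' ≤ V + V' :=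
      sup_le (le_add_of_nonneg_right hV'.2.1) (le_add_of_nonneg_left hV.2.1)
    exact ⟨V ⊔ V', ⟨(hV.1.add hV.2.1 hV'.2.1 hV'.1).mono h0 hle, h0, sup_le hV.2.2 hV'.2.2⟩,
      le_sup_left, le_sup_right⟩
  obtain ⟨U, hU, hpt⟩ := exists_isLUB_of_directedOn hD.out
    {V : Lr E D | PreservesInfZero V.1 ∧ 0 ≤ V ∧ V ≤ A} ⟨0, hzero, le_rfl, hA⟩ hdir
    (fun V hV => hV.2.1) ⟨A, fun V hV => hV.2.2⟩
  exact ⟨U, PreservesInfZero.of_isLUB (hU.1 ⟨hzero, le_rfl, hA⟩) hU hpt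
    fun V hV => ⟨hV.2.1, hV.1⟩, hU⟩

end OrderContinuousBand

end PreRiesz

/-! ### The main theorem -/

open PreRiesz in
theorem theorem3p2
    {E : Type u} [AddCommGroup E] [Lattice E] [IsOrderedAddMonoid E] [Module ℝ E]
    [IsOrderedModule ℝ E] (hE : IsArchimedean E)
    {F : Type v} [AddCommGroup F] [Lattice F] [IsOrderedAddMonoid F] [Module ℝ F]
    [IsOrderedModule ℝ F] (hF : IsArchimedean F)
    {Fδ : Type w} [AddCommGroup Fδ] [Lattice Fδ] [IsOrderedAddMonoid Fδ] [Module ℝ Fδ]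
    [IsOrderedModule ℝ Fδ] (i : F →ₗ[ℝ] Fδ) (hi : IsOrderCompletion i)
    (hperv : IsPervasive (LrInto E (LinearMap.range i))) :
    -- `𝓛ʳ(E, Fδ)` is a Riesz space, and its Riesz subspace generated by `𝓛ʳ(E, i(F))`, with the
    -- embedding `T ↦ i ∘ T`, is a Riesz completion of `𝓛ʳ(E, F)`
    (IsRieszSpace (Lr E Fδ) ∧
      ∃ j : Lr E F →ₗ[ℝ] rieszSubspaceGenerated (LrInto E (LinearMap.range i)),
        (∀ (T : Lr E F) (x : E), (j T).1.1 x = i (T.1 x)) ∧ IsRieszCompletion j) ∧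
    HasRieszKantorovichProperty E F ∧
    IsBand {T : Lr E F | IsOrderContinuous T.1} := by
  have : Fact (IsOrderComplete Fδ) := ⟨hi.orderComplete⟩
  have hbi := hi.bipositive
  let j := compLr E i hbi
  have hj : IsBipositive j := compLr_bipositive i hbi
  have hrange : Set.range j = LrInto E (LinearMap.range i) := range_compLr i hbi
  have hp : IsPervasive (Set.range j) := by rwa [hrange]
  have hArch : IsArchimedean (Lr E Fδ) := hi.orderComplete.isArchimedean.lr
  have hmaj : ∀ T, ∃ S, |j T| ≤ j S := fun T => by
    obtain ⟨A, hA, hTA⟩ := Lr.exists_pos_bound T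
    -- With `A ≥ 0` and `A ≥ T`, the operator `2A - T` dominates both `T` and `-T`.
    refine ⟨A + (A - T), abs_le'.2 ⟨hj.le_iff.2 (hTA.trans ?_), ?_⟩⟩
    · exact le_add_of_nonneg_right (sub_nonneg.2 hTA)
    · rw [← map_neg]
      refine hj.le_iff.2 ?_
      rw [← zero_sub]
      exact (sub_le_sub_right hA T).trans (le_add_of_nonneg_left hA)
  refine ⟨⟨isRieszSpace_of_lattice, _, fun T x => ?_,
    isRieszCompletion_codRestrict hArch j hj hp hmaj hrange⟩, ?_, ?_⟩
  · rfl
  · intro T P hP x hx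
    have h := hj.isLUB_pair hp hP
    rw [map_zero] at h
    have hlub := isLUB_posPart_apply (j T) hx
    rw [posPart_def, h] at hlub
    refine ⟨?_, fun u hu => hbi.le_iff.1 (hlub.2 ?_)⟩
    · rintro _ ⟨y, hy, rfl⟩
      exact hbi.le_iff.1 (hlub.1 ⟨y, hy, rfl⟩)
    · rintro _ ⟨y, hy, rfl⟩
      exact hbi.le_iff.2 (hu ⟨y, hy, rfl⟩)
  · have hset : {T : Lr E F | IsOrderContinuous T.1} =
        {T : Lr E F | |j T| ∈ {U : Lr E Fδ | PreservesInfZero U.1}} := by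
      ext T
      exact isOrderContinuous_iff hbi hi.pervasive hi.majorizing T
    rw [hset]
    refine isBand_setOf_abs_mem j hj hp (fun T => ?_) _ ?_ ?_ ?_ ?_ ?_
    · obtain ⟨S, hS⟩ := hmaj T
      have hp' : IsPervasive ((LinearMap.range j : Submodule ℝ (Lr E Fδ)) : Set (Lr E Fδ)) := by
        rwa [LinearMap.coe_range]
      exact hp'.isGLB hArch (LinearMap.mem_range_self j S) hS
    · exact preservesInfZero_of_nonneg le_rfl fun s ⟨b, hb⟩ _ _ w hw => hw b hb
    · exact fun a ha b hb hba => ha.mono hb hba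
    · exact fun a ha b hb ha0 hb0 => ha.add ha0 hb0 hb
    · exact fun c hc a ha => PreservesInfZero.smul hc ha
    · exact fun a ha => exists_isLUB_preservesInfZero ha
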